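/- Let $K$ be an infinite field, let $1\le a<b$ be integers, let $N\ge a$ be an integer, and let $R=K[x_0,\dots,x_N]$ be the homogeneous coordinate ring of $\mathbb{P}^N=\mathbb{P}^N_K$. For a linear subspace $L\subset\mathbb{P}^N$ let $I(L)\subset R$ be the ideal generated by the linear forms vanishing on $L$. A fat flat subscheme $W=\sum_{i=1}^t m_iL_i$ of $\mathbb{P}^N$ ($t\ge 1$, $m_i\ge 1$) is given by nonempty proper linear subspaces $L_i$, none of which contains another, and has the ideal $I(W)=\bigcap_i I(L_i)^{m_i}$. For a homogeneous ideal $I\ne 0$ let $\alpha(I)$ be the least degree of a nonzero homogeneous element of $I$, let $I^{(k)}=\bigcap_{P\in\mathrm{Ass}(R/I)}(I^kR_P\cap R)$, and let $\widehat\alpha(I)=\lim_{k\to\infty}\alpha(I^{(k)})/k$ be the Waldschmidt constant. Hyperplanes $H_1,\dots,H_s$ in $\mathbb{P}^N$ are in general position if any $j\le N+1$ of them meet in codimension exactly $j$ (for $j=N+1$: have empty intersection). For $1\le e\le\min(s,N)$ the star configuration $S_N(e,s)$ of such hyperplanes is the sum, with all multiplicities $1$, of the $\binom{s}{e}$ linear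 subspaces obtained by intersecting $e$ of them. For $m\ge 1$, a scheme of the form $W'+mS_N(e,s)$ is one where $W'=\sum_r m_rM_r$ is a finite (possibly empty) sum of distinct linear subspaces $M_r$ of codimensions between $2$ and $N$, each contained in $\bigcup_j H_j$ and none a member of $S_N(e,s)$, with $1\le m_r\le\lfloor m/e\rfloor$, such that no linear subspace occurring in $W'+mS_N(e,s)$ contains another one. Then there is a fat flat subscheme $W$ of $\mathbb{P}^N$ with $\widehat\alpha(I(W))=b/a$. More precisely: (1) for all positive integers $s,m$ with $b=sm$ and $s\ge a$, schemes of the form $W=W'+mS_N(a,s)$ exist, and every such $W$ (for any hyperplanes $H_1,\dots,H_s$ in general position) is a fat flat subscheme with $\widehat\alpha(I(W))=b/a$; (2) star configurations $W=S_N(a,b)$ exist in $\mathbb{P}^N$, and each of them (for any $b$ hyperplanes in general position) is a fat flat subscheme with $\widehat\alpha(I(W))=b/a$. -/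

import Mathlib

open Filter Topology

noncomputable section

namespace FatFlats

/-- Homogeneous coordinate ring `K[x_0, ..., x_N]` of `ℙ^N`. -/
abbrev CoordRing (K : Type*) [Field K] (N : ℕ) : Type _ := MvPolynomial (Fin (N + 1)) K

/-- Linear subspaces of `ℙ^N`, represented by their cones in `K^(N+1)`. The subspace has
codimension `i` in `ℙ^N` when its cone has dimension `N + 1 - i`; the zero cone is the empty set. -/
abbrev Flat (K : Type*) [Field K] (N : ℕ) : Type _ := Submodule K (Fin (N + 1) → K)

/-- The homogeneous ideal `I(L)` of a linear subspace `L`: it is generated by the linear forms that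
vanish on `L`. -/
def flatIdeal {K : Type*} [Field K] {N : ℕ} (L : Flat K N) : Ideal (CoordRing K N) :=
  Ideal.span {f | f.IsHomogeneous 1 ∧ ∀ v ∈ L, MvPolynomial.eval v f = 0}

/-- A finite formal sum `∑ m_i L_i` of linear subspaces with multiplicities `m_i ∈ ℕ`; terms of
multiplicity zero are not recorded. -/
abbrev FlatSum (K : Type*) [Field K] (N : ℕ) : Type _ := Flat K N →₀ ℕ

/-- The ideal `I(W) = ⋂ I(L_i) ^ m_i` of the formal sum `W = ∑ m_i L_i`. -/
def fatIdeal {K : Type*} [Field K] {N : ℕ} (W : FlatSum K N) : Ideal (CoordRing K N) :=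
  ⨅ L ∈ W.support, flatIdeal L ^ W L

/-- `W = ∑ m_i L_i` is a fat flat subscheme: there is at least one `L_i`, each `L_i` is a nonempty
proper linear subspace of `ℙ^N`, and none of the `L_i` contains another one. (The multiplicities
on the support are automatically at least `1`.) -/
structure IsFatFlat {K : Type*} [Field K] {N : ℕ} (W : FlatSum K N) : Prop where
  nonempty : W.support.Nonempty
  proper : ∀ L ∈ W.support, L ≠ ⊥ ∧ L ≠ ⊤
  antichain : IsAntichain (· ≤ ·) (W.support : Set (Flat K N))

/-- The `k`-th symbolic power `I^(k)`: the intersection over `P ∈ Ass(R/I)` of the contractions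
to `R` of `I^k R_P`. -/
def symbolicPower {R : Type*} [CommRing R] (I : Ideal R) (k : ℕ) : Ideal R :=
  ⨅ (P : PrimeSpectrum R) (_ : P.asIdeal ∈ associatedPrimes R (R ⧸ I)),
    ((I ^ k).map (algebraMap R (Localization.AtPrime P.asIdeal))).comap
      (algebraMap R (Localization.AtPrime P.asIdeal))

/-- `α(I)`: the least degree of a nonzero homogeneous element of `I`. -/
def initialDegree {K : Type*} [Field K] {N : ℕ} (I : Ideal (CoordRing K N)) : ℕ :=
  sInf {t : ℕ | ∃ f ∈ I, f ≠ 0 ∧ f.IsHomogeneous t}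

/-- The Waldschmidt constant of `I`, the limit of `α(I^(k)) / k`, exists and equals `c`. -/
def HasWaldschmidtConstant {K : Type*} [Field K] {N : ℕ} (I : Ideal (CoordRing K N)) (c : ℝ) :
    Prop :=
  Tendsto (fun k : ℕ => (initialDegree (symbolicPower I k) : ℝ) / k) atTop (𝓝 c)

/-- `H_1, ..., H_s` are hyperplanes of `ℙ^N` in general position: any `j ≤ N + 1` of them meet in
codimension exactly `j` (the case `j = 1` says that they are hyperplanes). -/
def InGeneralPosition {K : Type*} [Field K] {N s : ℕ} (H : Fin s → Flat K N) : Prop :=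
  ∀ J : Finset (Fin s), J.card ≤ N + 1 → Module.finrank K ↥(J.inf H) + J.card = N + 1

/-- The star configuration `S_N(e,s)` of the hyperplanes `H_1, ..., H_s`: the sum, with
multiplicity one, of all intersections of `e` of these hyperplanes. -/
def star {K : Type*} [Field K] {N s : ℕ} (H : Fin s → Flat K N) (e : ℕ) : FlatSum K N :=
  ∑ J ∈ (Finset.univ : Finset (Fin s)).powersetCard e, Finsupp.single (J.inf H) 1

/-- `W'` may be added to `m S_N(e,s)`: it is a finite sum of linear subspaces `M` of codimensions
between `2` and `N`, contained in the union of the hyperplanes, different from the members of the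
star configuration, with multiplicities at most `⌊m/e⌋`, such that no linear subspace occurring in
`W' + m S_N(e,s)` contains another one. -/
structure IsAdmissible {K : Type*} [Field K] {N s : ℕ} (H : Fin s → Flat K N) (e m : ℕ)
    (W' : FlatSum K N) : Prop where
  codim : ∀ M ∈ W'.support, ∃ i, 2 ≤ i ∧ i ≤ N ∧ Module.finrank K ↥M + i = N + 1
  subset_union : ∀ M ∈ W'.support, (M : Set (Fin (N + 1) → K)) ⊆ ⋃ j, (H j : Set (Fin (N + 1) → K))
  disjoint_star : Disjoint W'.support (star H e).support
  mult_le : ∀ M, W' M ≤ m / e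
  antichain : IsAntichain (· ≤ ·) ((W' + m • star H e).support : Set (Flat K N))

end FatFlats

end

/-!
The order of vanishing along a flat is a valuation, and the `k`-th symbolic power of the ideal of
`∑ m_i L_i` consists of the `f` that vanish to order at least `m_i k` along each `L_i`. Every flat
of `W' + m S_N(e,s)` lies in some hyperplane, and a member of the star configuration lies in `e` of
them, so the `q`-th power of the product of the `s` equations, `q` about `m k / e`, lies in the
`k`-th symbolic power; this bounds the Waldschmidt constant by `s m / e` from above.

For the lower bound, the orders of `f ≠ 0` along the `s.choose e` members of the star configuration
add up to at most `(s - 1).choose (e - 1)` times the degree of `f`. Equality holds for the equation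
of a hyperplane, so these equations may be divided out of `f`. What is left restricts to a nonzero
polynomial on each hyperplane `H j`, where the other hyperplanes cut out a star configuration of
codimension `e - 1`; induction there and summation over `j` count every order `e` times.
-/

noncomputable section

namespace FatFlats

section LinearForms

theorem dualBasis_basisFun {R ι : Type*} [CommRing R] [Finite ι] [DecidableEq ι] (i : ι) :
    (Pi.basisFun R ι).dualBasis i = LinearMap.proj i := by
  ext
  simp

theorem dual_linearMap_ext {R ι V : Type*} [CommRing R] [Finite ι] [AddCommMonoid V] [Module R V]
    {φ φ' : Module.Dual R (ι → R) →ₗ[R] V}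
    (h : ∀ i, φ (LinearMap.proj i) = φ' (LinearMap.proj i)) : φ = φ' := by
  classical
  exact (Pi.basisFun R ι).dualBasis.ext fun i => by rw [dualBasis_basisFun, h]

variable {K : Type*} [Field K] {N M : ℕ}

/-- The linear form on `ℙ^N` attached to a functional on `K^(N+1)`. -/
def linForm : Module.Dual K (Fin (N + 1) → K) →ₗ[K] CoordRing K N :=
  (Pi.basisFun K (Fin (N + 1))).dualBasis.constr K MvPolynomial.X

@[simp]
theorem linForm_proj (i : Fin (N + 1)) :
    linForm (LinearMap.proj i : Module.Dual K (Fin (N + 1) → K)) = MvPolynomial.X i := by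
  rw [linForm, ← dualBasis_basisFun, Module.Basis.constr_basis]

@[simp]
theorem eval_linForm (ψ : Module.Dual K (Fin (N + 1) → K)) (v : Fin (N + 1) → K) :
    MvPolynomial.eval v (linForm ψ) = ψ v := by
  have h : (MvPolynomial.aeval v).toLinearMap ∘ₗ linForm =
      Module.Dual.eval K (Fin (N + 1) → K) v :=
    dual_linearMap_ext fun i => by simp
  exact LinearMap.congr_fun h ψ

theorem linForm_injective :
    Function.Injective (linForm : Module.Dual K (Fin (N + 1) → K) →ₗ[K] CoordRing K N) :=
  fun ψ ψ' h => LinearMap.ext fun v => by rw [← eval_linForm, h, eval_linForm]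

theorem range_linForm :
    LinearMap.range (linForm : Module.Dual K (Fin (N + 1) → K) →ₗ[K] CoordRing K N) =
      MvPolynomial.homogeneousSubmodule (Fin (N + 1)) K 1 := by
  rw [linForm, Module.Basis.constr_range, MvPolynomial.homogeneousSubmodule_one_eq_span_X]

theorem isHomogeneous_linForm (ψ : Module.Dual K (Fin (N + 1) → K)) :
    (linForm ψ).IsHomogeneous 1 := by
  rw [← MvPolynomial.mem_homogeneousSubmodule, ← range_linForm]
  exact LinearMap.mem_range_self linForm ψ

theorem totalDegree_linForm {ψ : Module.Dual K (Fin (N + 1) → K)} (hψ : ψ ≠ 0) :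
    (linForm ψ).totalDegree = 1 :=
  (isHomogeneous_linForm ψ).totalDegree ((map_ne_zero_iff _ linForm_injective).2 hψ)

/-- The extension of a linear map on functionals to the coordinate ring, seen as the symmetric
algebra on `(K^(N+1))*`. -/
def liftDual {S : Type*} [CommRing S] [Algebra K S]
    (φ : Module.Dual K (Fin (N + 1) → K) →ₗ[K] S) : CoordRing K N →ₐ[K] S :=
  MvPolynomial.aeval fun i => φ (LinearMap.proj i)

@[simp]
theorem liftDual_linForm {S : Type*} [CommRing S] [Algebra K S]
    (φ : Module.Dual K (Fin (N + 1) → K) →ₗ[K] S) (ψ : Module.Dual K (Fin (N + 1) → K)) :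
    liftDual φ (linForm ψ) = φ ψ := by
  have h : (liftDual φ).toLinearMap ∘ₗ linForm = φ :=
    dual_linearMap_ext fun i => by simp [liftDual]
  exact LinearMap.congr_fun h ψ

theorem algHom_ext_linForm {S : Type*} [CommRing S] [Algebra K S]
    {φ φ' : CoordRing K N →ₐ[K] S} (h : ∀ ψ, φ (linForm ψ) = φ' (linForm ψ)) : φ = φ' :=
  MvPolynomial.algHom_ext fun i => by simpa only [linForm_proj] using h (LinearMap.proj i)

/-- Substitution of a linear map `A` into polynomial functions, `f ↦ f ∘ A`. -/
def pullback (A : (Fin (M + 1) → K) →ₗ[K] (Fin (N + 1) → K)) :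
    CoordRing K N →ₐ[K] CoordRing K M :=
  liftDual (linForm ∘ₗ A.dualMap)

@[simp]
theorem pullback_linForm (A : (Fin (M + 1) → K) →ₗ[K] (Fin (N + 1) → K))
    (ψ : Module.Dual K (Fin (N + 1) → K)) : pullback A (linForm ψ) = linForm (ψ ∘ₗ A) :=
  liftDual_linForm _ ψ

theorem totalDegree_pullback_le (A : (Fin (M + 1) → K) →ₗ[K] (Fin (N + 1) → K))
    (f : CoordRing K N) : (pullback A f).totalDegree ≤ f.totalDegree := by
  rw [pullback, liftDual, MvPolynomial.aeval_def, MvPolynomial.eval₂_eq]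
  refine MvPolynomial.totalDegree_finsetSum_le fun d hd => ?_
  rw [MvPolynomial.algebraMap_eq, ← MvPolynomial.smul_eq_C_mul]
  refine (MvPolynomial.totalDegree_smul_le _ _).trans ?_
  refine (MvPolynomial.totalDegree_finsetProd _ _).trans ?_
  refine le_trans (Finset.sum_le_sum fun i _ => ?_) (MvPolynomial.le_totalDegree hd)
  refine (MvPolynomial.totalDegree_pow _ _).trans ?_
  exact mul_le_of_le_one_right' (isHomogeneous_linForm _).totalDegree_le

end LinearForms

section FlatIdeals

variable {K : Type*} [Field K] {N M : ℕ} {L : Flat K N} {ψ : Module.Dual K (Fin (N + 1) → K)}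

theorem linForm_mem_flatIdeal (h : L ≤ LinearMap.ker ψ) : linForm ψ ∈ flatIdeal L :=
  Ideal.subset_span ⟨isHomogeneous_linForm ψ, fun v hv => by rw [eval_linForm]; exact h hv⟩

theorem flatIdeal_le_iff {I : Ideal (CoordRing K N)} :
    flatIdeal L ≤ I ↔ ∀ ψ, L ≤ LinearMap.ker ψ → linForm ψ ∈ I := by
  refine ⟨fun h ψ hψ => h (linForm_mem_flatIdeal hψ), fun h => Ideal.span_le.2 ?_⟩
  rintro f ⟨hf, hfL⟩
  rw [← MvPolynomial.mem_homogeneousSubmodule, ← range_linForm] at hf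
  obtain ⟨ψ, rfl⟩ := hf
  exact h ψ fun v hv => by rw [LinearMap.mem_ker, ← eval_linForm, hfL v hv]

theorem map_pullback_flatIdeal_le (A : (Fin (M + 1) → K) →ₗ[K] (Fin (N + 1) → K)) :
    (flatIdeal L).map (pullback A) ≤ flatIdeal (L.comap A) := by
  refine Ideal.map_le_iff_le_comap.2 (flatIdeal_le_iff.2 fun ψ hψ => ?_)
  rw [Ideal.mem_comap, pullback_linForm]
  exact linForm_mem_flatIdeal fun v hv => hψ hv

end FlatIdeals

section VanishingOrder

variable {K : Type*} [Field K] {N M : ℕ}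

/-- A linear projection of `K^(N+1)` onto the cone `L`. -/
def projOnto (L : Flat K N) : (Fin (N + 1) → K) →ₗ[K] (Fin (N + 1) → K) :=
  L.subtype ∘ₗ L.subtype.leftInverse

theorem projOnto_mem (L : Flat K N) (v : Fin (N + 1) → K) : projOnto L v ∈ L :=
  (L.subtype.leftInverse v).2

theorem projOnto_of_mem {L : Flat K N} {v : Fin (N + 1) → K} (hv : v ∈ L) :
    projOnto L v = v :=
  congrArg L.subtype (L.subtype.leftInverse_apply_of_inj L.ker_subtype ⟨v, hv⟩)

theorem comp_projOnto_eq_zero_iff {L : Flat K N} {ψ : Module.Dual K (Fin (N + 1) → K)} :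
    ψ ∘ₗ projOnto L = 0 ↔ L ≤ LinearMap.ker ψ := by
  refine ⟨fun h v hv => ?_, fun h => LinearMap.ext fun v => h (projOnto_mem L v)⟩
  rw [LinearMap.mem_ker, ← projOnto_of_mem hv]
  exact LinearMap.congr_fun h v

/-- The family of substitutions `f ↦ f (π v + T (v - π v))`, where `π` is a projection onto `L`:
it is `f ∘ π` at `T = 0` and `f` at `T = 1`. -/
def normalScaling (L : Flat K N) : CoordRing K N →ₐ[K] Polynomial (CoordRing K N) :=
  liftDual <|
    Polynomial.CAlgHom.toLinearMap ∘ₗ linForm ∘ₗ (projOnto L).dualMap +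
      LinearMap.mulLeft K Polynomial.X ∘ₗ Polynomial.CAlgHom.toLinearMap ∘ₗ linForm ∘ₗ
        (LinearMap.id - projOnto L).dualMap

theorem normalScaling_linForm (L : Flat K N) (ψ : Module.Dual K (Fin (N + 1) → K)) :
    normalScaling L (linForm ψ) = Polynomial.C (linForm (ψ ∘ₗ projOnto L)) +
      Polynomial.X * Polynomial.C (linForm (ψ ∘ₗ (LinearMap.id - projOnto L))) :=
  liftDual_linForm _ ψ

theorem normalScaling_linForm_of_le {L : Flat K N} {ψ : Module.Dual K (Fin (N + 1) → K)}
    (h : L ≤ LinearMap.ker ψ) :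
    normalScaling L (linForm ψ) = Polynomial.X * Polynomial.C (linForm ψ) := by
  rw [normalScaling_linForm, LinearMap.comp_sub, comp_projOnto_eq_zero_iff.2 h, map_zero, map_zero,
    zero_add, sub_zero, LinearMap.comp_id]

theorem eval_one_normalScaling (L : Flat K N) (f : CoordRing K N) :
    (normalScaling L f).eval 1 = f := by
  have h : ((Polynomial.aeval (1 : CoordRing K N)).restrictScalars K).comp (normalScaling L) =
      AlgHom.id K _ :=
    algHom_ext_linForm fun ψ => by
      simp [normalScaling_linForm, LinearMap.comp_sub]
  simpa using AlgHom.congr_fun h f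

theorem coeff_zero_normalScaling (L : Flat K N) (f : CoordRing K N) :
    (normalScaling L f).coeff 0 = pullback (projOnto L) f := by
  have h : ((Polynomial.aeval (0 : CoordRing K N)).restrictScalars K).comp (normalScaling L) =
      pullback (projOnto L) :=
    algHom_ext_linForm fun ψ => by simp [normalScaling_linForm]
  simpa [Polynomial.coeff_zero_eq_eval_zero] using AlgHom.congr_fun h f

theorem normalScaling_mem_reesAlgebra (L : Flat K N) (f : CoordRing K N) :
    normalScaling L f ∈ reesAlgebra (flatIdeal L) := by
  have hC (g : CoordRing K N) : Polynomial.C g ∈ reesAlgebra (flatIdeal L) :=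
    (reesAlgebra (flatIdeal L)).algebraMap_mem g
  have hlin (ψ : Module.Dual K (Fin (N + 1) → K)) :
      normalScaling L (linForm ψ) ∈ reesAlgebra (flatIdeal L) := by
    rw [normalScaling_linForm, Polynomial.X_mul_C, Polynomial.C_mul_X_eq_monomial]
    refine add_mem (hC _) (reesAlgebra.monomial_mem.2 ?_)
    rw [pow_one]
    exact linForm_mem_flatIdeal fun v hv => by simp [projOnto_of_mem hv]
  induction f using MvPolynomial.induction_on with
  | C c =>
    rw [← MvPolynomial.algebraMap_eq, AlgHom.commutes]
    exact hC _
  | add p q hp hq =>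
    rw [map_add]
    exact add_mem hp hq
  | mul_X p i hp =>
    rw [map_mul, ← linForm_proj]
    exact mul_mem hp (hlin _)

theorem X_pow_dvd_normalScaling_iff {L : Flat K N} {n : ℕ} {f : CoordRing K N} :
    Polynomial.X ^ n ∣ normalScaling L f ↔ f ∈ flatIdeal L ^ n := by
  constructor
  · intro h
    rw [← eval_one_normalScaling L f, Polynomial.eval_eq_sum_range]
    refine Ideal.sum_mem _ fun i _ => ?_
    rw [one_pow, mul_one]
    rcases lt_or_ge i n with hi | hi
    · rw [Polynomial.X_pow_dvd_iff.1 h i hi]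
      exact Ideal.zero_mem _
    · exact Ideal.pow_le_pow_right hi (normalScaling_mem_reesAlgebra L f i)
  · intro hf
    have hmap : (flatIdeal L).map (normalScaling L) ≤ Ideal.span {Polynomial.X} := by
      refine Ideal.map_le_iff_le_comap.2 (flatIdeal_le_iff.2 fun ψ hψ => ?_)
      rw [Ideal.mem_comap, Ideal.mem_span_singleton, normalScaling_linForm_of_le hψ]
      exact dvd_mul_right _ _
    rw [← Ideal.mem_span_singleton, ← Ideal.span_singleton_pow]
    refine Ideal.pow_right_mono hmap n ?_
    rw [← Ideal.map_pow]
    exact Ideal.mem_map_of_mem _ hf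

/-- The order of vanishing of `f` along the flat `L`, that is, the `I(L)`-adic order of `f`
(see `le_vanishingOrder_iff`). -/
def vanishingOrder (L : Flat K N) (f : CoordRing K N) : ℕ∞ :=
  emultiplicity Polynomial.X (normalScaling L f)

theorem le_vanishingOrder_iff {L : Flat K N} {n : ℕ} {f : CoordRing K N} :
    n ≤ vanishingOrder L f ↔ f ∈ flatIdeal L ^ n := by
  rw [vanishingOrder, ← pow_dvd_iff_le_emultiplicity, X_pow_dvd_normalScaling_iff]

theorem vanishingOrder_mul (L : Flat K N) (f g : CoordRing K N) :
    vanishingOrder L (f * g) = vanishingOrder L f + vanishingOrder L g := by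
  rw [vanishingOrder, map_mul, emultiplicity_mul Polynomial.prime_X]
  rfl

theorem vanishingOrder_eq_zero_iff {L : Flat K N} {f : CoordRing K N} :
    vanishingOrder L f = 0 ↔ f ∉ flatIdeal L := by
  rw [← not_iff_not, not_not, ← ne_eq, ← Order.one_le_iff_ne_zero, ← Nat.cast_one,
    le_vanishingOrder_iff, pow_one]

theorem mem_flatIdeal_iff {L : Flat K N} {f : CoordRing K N} :
    f ∈ flatIdeal L ↔ pullback (projOnto L) f = 0 := by
  rw [← coeff_zero_normalScaling, ← Polynomial.X_dvd_iff, ← pow_one (flatIdeal L),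
    ← X_pow_dvd_normalScaling_iff, pow_one]

theorem linForm_mem_flatIdeal_iff {L : Flat K N} {ψ : Module.Dual K (Fin (N + 1) → K)} :
    linForm ψ ∈ flatIdeal L ↔ L ≤ LinearMap.ker ψ := by
  rw [mem_flatIdeal_iff, pullback_linForm, map_eq_zero_iff _ linForm_injective,
    comp_projOnto_eq_zero_iff]

instance isPrime_flatIdeal (L : Flat K N) : (flatIdeal L).IsPrime := by
  have h : flatIdeal L = RingHom.ker (pullback (projOnto L)) := by
    ext f
    rw [mem_flatIdeal_iff, RingHom.mem_ker]
  rw [h]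
  exact RingHom.ker_isPrime _

theorem flatIdeal_le_flatIdeal_iff {L L' : Flat K N} :
    flatIdeal L' ≤ flatIdeal L ↔ L ≤ L' := by
  refine ⟨fun h => ?_, fun h => flatIdeal_le_iff.2 fun ψ hψ => linForm_mem_flatIdeal (h.trans hψ)⟩
  rw [← Subspace.dualAnnihilator_le_dualAnnihilator_iff]
  intro ψ hψ
  rw [Submodule.mem_dualAnnihilator] at hψ ⊢
  exact linForm_mem_flatIdeal_iff.1 (h (linForm_mem_flatIdeal hψ))

theorem isPrimary_flatIdeal_pow (L : Flat K N) {n : ℕ} (hn : n ≠ 0) :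
    (flatIdeal L ^ n).IsPrimary := by
  rw [Ideal.isPrimary_iff, Ideal.radical_pow _ hn, (isPrime_flatIdeal L).radical]
  refine ⟨fun h => (isPrime_flatIdeal L).ne_top (Ideal.pow_eq_top_iff.1 h |>.resolve_right hn),
    fun {f g} hfg => or_iff_not_imp_right.2 fun hg => ?_⟩
  rw [← le_vanishingOrder_iff] at hfg ⊢
  rwa [vanishingOrder_mul, vanishingOrder_eq_zero_iff.2 hg, add_zero] at hfg

theorem vanishingOrder_linForm_of_le {L : Flat K N} {ψ : Module.Dual K (Fin (N + 1) → K)}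
    (hψ : ψ ≠ 0) (hL : L ≤ LinearMap.ker ψ) : vanishingOrder L (linForm ψ) = 1 := by
  have hX : ¬ Polynomial.X ∣ Polynomial.C (linForm ψ) := by
    rwa [Polynomial.X_dvd_iff, Polynomial.coeff_C_zero, map_eq_zero_iff _ linForm_injective]
  rw [vanishingOrder, normalScaling_linForm_of_le hL, emultiplicity_mul Polynomial.prime_X,
    emultiplicity_eq_zero.2 hX, add_zero]
  exact FiniteMultiplicity.emultiplicity_self
    (.of_prime_left Polynomial.prime_X Polynomial.X_ne_zero)

theorem vanishingOrder_linForm_of_not_le {L : Flat K N} {ψ : Module.Dual K (Fin (N + 1) → K)}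
    (hL : ¬ L ≤ LinearMap.ker ψ) : vanishingOrder L (linForm ψ) = 0 := by
  rwa [vanishingOrder_eq_zero_iff, linForm_mem_flatIdeal_iff]

theorem vanishingOrder_le_pullback (A : (Fin (M + 1) → K) →ₗ[K] (Fin (N + 1) → K))
    (L : Flat K N) (f : CoordRing K N) :
    vanishingOrder L f ≤ vanishingOrder (L.comap A) (pullback A f) := by
  refine ENat.forall_natCast_le_iff_le.1 fun n hn => ?_
  rw [le_vanishingOrder_iff] at hn ⊢
  refine Ideal.pow_right_mono (map_pullback_flatIdeal_le A) n ?_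
  rw [← Ideal.map_pow]
  exact Ideal.mem_map_of_mem _ hn

theorem mem_span_singleton_of_ker_le_ker {V : Type*} [AddCommGroup V] [Module K V]
    {ψ ψ' : Module.Dual K V} (h : LinearMap.ker ψ ≤ LinearMap.ker ψ') :
    ψ' ∈ Submodule.span K {ψ} := by
  rw [← Set.range_const (ι := Unit)]
  exact mem_span_of_iInf_ker_le_ker (by rwa [iInf_const])

theorem linForm_dvd_of_mem_flatIdeal_ker {ψ : Module.Dual K (Fin (N + 1) → K)}
    {f : CoordRing K N} (hf : f ∈ flatIdeal (LinearMap.ker ψ)) : linForm ψ ∣ f := by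
  rw [← Ideal.mem_span_singleton]
  refine flatIdeal_le_iff.2 (fun ψ' hψ' => ?_) hf
  obtain ⟨c, rfl⟩ := Submodule.mem_span_singleton.1 (mem_span_singleton_of_ker_le_ker hψ')
  rw [map_smul, Ideal.mem_span_singleton]
  exact dvd_smul_of_dvd c dvd_rfl

end VanishingOrder

section Counting

variable {ι : Type*} [DecidableEq ι]

theorem sum_powersetCard_filter_mem {R : Type*} [AddCommMonoid R] {S : Finset ι} {j : ι}
    (hj : j ∈ S) (a : ℕ) (n : Finset ι → R) :
    ∑ J ∈ S.powersetCard (a + 1) with j ∈ J, n J =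
      ∑ J ∈ (S.erase j).powersetCard a, n (insert j J) := by
  have hnotMem {J : Finset ι} (hJ : J ∈ (S.erase j).powersetCard a) : j ∉ J := fun h =>
    Finset.notMem_erase j S ((Finset.mem_powersetCard.1 hJ).1 h)
  symm
  refine Finset.sum_nbij' (insert j) (Finset.erase · j) (fun J hJ => ?_) (fun J hJ => ?_)
    (fun J hJ => Finset.erase_insert (hnotMem hJ))
    (fun J hJ => Finset.insert_erase (Finset.mem_filter.1 hJ).2) (fun J _ => rfl)
  · obtain ⟨hJS, hJa⟩ := Finset.mem_powersetCard.1 hJ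
    rw [Finset.mem_filter, Finset.mem_powersetCard, Finset.card_insert_of_notMem (hnotMem hJ), hJa]
    exact ⟨⟨Finset.insert_subset hj (hJS.trans (Finset.erase_subset j S)), rfl⟩,
      Finset.mem_insert_self j J⟩
  · obtain ⟨hJ, hjJ⟩ := Finset.mem_filter.1 hJ
    obtain ⟨hJS, hJa⟩ := Finset.mem_powersetCard.1 hJ
    rw [Finset.mem_powersetCard, Finset.card_erase_of_mem hjJ, hJa]
    exact ⟨Finset.erase_subset_erase j hJS, rfl⟩

theorem card_powersetCard_filter_mem {S : Finset ι} {j : ι} (hj : j ∈ S) (a : ℕ) :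
    (S.powersetCard (a + 1) |>.filter (j ∈ ·)).card = (S.card - 1).choose a := by
  rw [Finset.card_eq_sum_ones, sum_powersetCard_filter_mem hj, ← Finset.card_eq_sum_ones,
    Finset.card_powersetCard, Finset.card_erase_of_mem hj]

theorem sum_sum_powersetCard_filter_mem {R : Type*} [AddCommMonoid R] (S : Finset ι) (a : ℕ)
    (n : Finset ι → R) :
    ∑ j ∈ S, ∑ J ∈ S.powersetCard a with j ∈ J, n J = a • ∑ J ∈ S.powersetCard a, n J := by
  simp_rw [Finset.sum_filter]
  rw [Finset.sum_comm, Finset.smul_sum]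
  refine Finset.sum_congr rfl fun J hJ => ?_
  obtain ⟨hJS, hJa⟩ := Finset.mem_powersetCard.1 hJ
  rw [← Finset.sum_filter, Finset.filter_mem_eq_inter, Finset.inter_eq_right.2 hJS,
    Finset.sum_const, hJa]

theorem add_two_mul_choose_le (t a : ℕ) :
    (t + 2) * t.choose a ≤ (a + 2) * (t + 1).choose (a + 1) := by
  have hrec := Nat.add_one_mul_choose_eq t a
  have hle : t.choose a ≤ (t + 1).choose (a + 1) := by
    rw [Nat.choose_succ_succ]
    exact Nat.le_add_right _ _
  nlinarith

end Counting

section LinearIndepUpTo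

/-- Any at most `k` members of the family `v` with indices in `S` are linearly independent. For
functionals this is general position of their kernels, see `inGeneralPosition_ker_iff`. -/
def LinearIndepUpTo (K : Type*) {ι V : Type*} [Field K] [AddCommGroup V] [Module K V]
    (v : ι → V) (S : Finset ι) (k : ℕ) : Prop :=
  ∀ J ⊆ S, J.card ≤ k → LinearIndepOn K v (J : Set ι)

namespace LinearIndepUpTo

variable {K ι V V' : Type*} [Field K] [AddCommGroup V] [Module K V] [AddCommGroup V']
  [Module K V'] {v : ι → V} {S T : Finset ι} {k l : ℕ}

theorem mono (h : LinearIndepUpTo K v S k) (hTS : T ⊆ S) (hlk : l ≤ k) :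
    LinearIndepUpTo K v T l :=
  fun J hJ hJl => h J (hJ.trans hTS) (hJl.trans hlk)

theorem notMem_span (h : LinearIndepUpTo K v S k) {J : Finset ι} {j : ι} (hJ : J ⊆ S)
    (hJk : J.card < k) (hj : j ∈ S) (hjJ : j ∉ J) : v j ∉ Submodule.span K (v '' J) := by
  classical
  have hins := h (insert j J) (Finset.insert_subset hj hJ)
    (by rwa [Finset.card_insert_of_notMem hjJ])
  rw [Finset.coe_insert, linearIndepOn_insert (by exact_mod_cast hjJ)] at hins
  exact hins.2

theorem ne_zero (h : LinearIndepUpTo K v S (k + 1)) {j : ι} (hj : j ∈ S) : v j ≠ 0 := by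
  simpa using h.notMem_span (Finset.empty_subset S) k.succ_pos hj (Finset.notMem_empty j)

theorem erase_map [DecidableEq ι] (h : LinearIndepUpTo K v S (k + 1)) {j : ι} (hj : j ∈ S)
    (φ : V →ₗ[K] V') (hφ : LinearMap.ker φ ≤ Submodule.span K {v j}) :
    LinearIndepUpTo K (φ ∘ v) (S.erase j) k := by
  intro J hJ hJk
  have hJS : J ⊆ S := hJ.trans (Finset.erase_subset j S)
  have hjJ : j ∉ J := fun hjJ => Finset.notMem_erase j S (hJ hjJ)
  have hdisj : Disjoint (Submodule.span K (v '' J)) (LinearMap.ker φ) :=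
    ((Submodule.disjoint_span_singleton' (h.ne_zero hj)).2
      (h.notMem_span hJS (Nat.lt_succ_of_le hJk) hj hjJ)).mono_right hφ
  exact (h J hJS (hJk.trans k.le_succ)).map_injOn φ (LinearMap.injOn_of_disjoint_ker le_rfl hdisj)

end LinearIndepUpTo

end LinearIndepUpTo

section LowerBound

variable {K : Type*} [Field K] {N : ℕ} {ι : Type*} {S : Finset ι}
  {ψ : ι → Module.Dual K (Fin (N + 1) → K)}

theorem LinearIndepUpTo.inf_ker_le_ker_iff {k : ℕ} (h : LinearIndepUpTo K ψ S k) {J : Finset ι}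
    {j : ι} (hJ : J ⊆ S) (hJk : J.card < k) (hj : j ∈ S) :
    J.inf (fun i => LinearMap.ker (ψ i)) ≤ LinearMap.ker (ψ j) ↔ j ∈ J := by
  refine ⟨fun hle => ?_, fun hjJ => Finset.inf_le hjJ⟩
  by_contra hjJ
  refine h.notMem_span hJ hJk hj hjJ ?_
  rw [← Subtype.range_coe (s := (J : Set ι)), ← Set.range_comp]
  refine mem_span_of_iInf_ker_le_ker (le_trans ?_ hle)
  exact Finset.le_inf fun i hi => iInf_le (fun i : J => LinearMap.ker (ψ i)) ⟨i, hi⟩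

/-- Composing with the projection plays the part of restricting to the hyperplane `ker (ψ j)`, and
keeps the ambient space fixed in the induction. -/
theorem LinearIndepUpTo.erase_comp_projOnto [DecidableEq ι] {k : ℕ}
    (h : LinearIndepUpTo K ψ S (k + 1)) {j : ι} (hj : j ∈ S) :
    LinearIndepUpTo K (fun i => ψ i ∘ₗ projOnto (LinearMap.ker (ψ j))) (S.erase j) k :=
  h.erase_map hj (projOnto (LinearMap.ker (ψ j))).dualMap fun _ hφ =>
    mem_span_singleton_of_ker_le_ker (comp_projOnto_eq_zero_iff.1 hφ)

/-- The total order of vanishing of `f` along the intersections of `e` of the hyperplanes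
`ker (ψ j)` with `j ∈ S`. -/
def orderSum (ψ : ι → Module.Dual K (Fin (N + 1) → K)) (S : Finset ι) (e : ℕ)
    (f : CoordRing K N) : ℕ∞ :=
  ∑ J ∈ S.powersetCard e, vanishingOrder (J.inf fun j => LinearMap.ker (ψ j)) f

theorem orderSum_mul (e : ℕ) (f g : CoordRing K N) :
    orderSum ψ S e (f * g) = orderSum ψ S e f + orderSum ψ S e g := by
  simp only [orderSum, vanishingOrder_mul, Finset.sum_add_distrib]

theorem orderSum_linForm {a : ℕ} (h : LinearIndepUpTo K ψ S (a + 2)) {j : ι} (hj : j ∈ S) :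
    orderSum ψ S (a + 1) (linForm (ψ j)) = ((S.card - 1).choose a : ℕ) := by
  classical
  rw [orderSum, ← card_powersetCard_filter_mem hj, Finset.card_filter, Nat.cast_sum]
  refine Finset.sum_congr rfl fun J hJ => ?_
  obtain ⟨hJS, hJa⟩ := Finset.mem_powersetCard.1 hJ
  have hle := h.inf_ker_le_ker_iff hJS (hJa ▸ Nat.lt_succ_self _) hj
  split_ifs with hjJ
  · rw [vanishingOrder_linForm_of_le (h.ne_zero hj) (hle.2 hjJ), Nat.cast_one]
  · rw [vanishingOrder_linForm_of_not_le (mt hle.1 hjJ), Nat.cast_zero]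

theorem orderSum_le_of_forall_not_dvd {a : ℕ} (h : LinearIndepUpTo K ψ S (a + 2))
    (hbound : ∀ g : CoordRing K N, (∀ j ∈ S, ¬ linForm (ψ j) ∣ g) →
      orderSum ψ S (a + 1) g ≤ (g.totalDegree * (S.card - 1).choose a : ℕ))
    {f : CoordRing K N} (hf : f ≠ 0) :
    orderSum ψ S (a + 1) f ≤ (f.totalDegree * (S.card - 1).choose a : ℕ) := by
  induction hd : f.totalDegree using Nat.strong_induction_on generalizing f with | _ d ih
  by_cases hdvd : ∀ j ∈ S, ¬ linForm (ψ j) ∣ f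
  · exact hd ▸ hbound f hdvd
  push Not at hdvd
  obtain ⟨j, hj, g, rfl⟩ := hdvd
  have hg : g ≠ 0 := right_ne_zero_of_mul hf
  have hdeg : d = g.totalDegree + 1 := by
    rw [← hd, MvPolynomial.totalDegree_mul_of_isDomain (left_ne_zero_of_mul hf) hg,
      totalDegree_linForm (h.ne_zero hj), add_comm]
  rw [orderSum_mul, orderSum_linForm h hj, hdeg, add_one_mul, add_comm, Nat.cast_add]
  gcongr
  exact ih _ (hdeg ▸ Nat.lt_succ_self _) hg rfl

theorem orderSum_one_eq_zero {f : CoordRing K N} (hf : ∀ j ∈ S, ¬ linForm (ψ j) ∣ f) :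
    orderSum ψ S 1 f = 0 := by
  refine Finset.sum_eq_zero fun J hJ => ?_
  obtain ⟨hJS, hJ1⟩ := Finset.mem_powersetCard.1 hJ
  obtain ⟨j, rfl⟩ := Finset.card_eq_one.1 hJ1
  rw [Finset.inf_singleton, vanishingOrder_eq_zero_iff]
  exact mt linForm_dvd_of_mem_flatIdeal_ker (hf j (Finset.singleton_subset_iff.1 hJS))

theorem sum_vanishingOrder_filter_mem_le [DecidableEq ι] {j : ι} (hj : j ∈ S) (e : ℕ)
    (f : CoordRing K N) :
    ∑ J ∈ S.powersetCard (e + 1) with j ∈ J,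
        vanishingOrder (J.inf fun i => LinearMap.ker (ψ i)) f ≤
      orderSum (fun i => ψ i ∘ₗ projOnto (LinearMap.ker (ψ j))) (S.erase j) e
        (pullback (projOnto (LinearMap.ker (ψ j))) f) := by
  rw [sum_powersetCard_filter_mem hj]
  refine Finset.sum_le_sum fun J _ => ?_
  set π := projOnto (LinearMap.ker (ψ j))
  have hcomap : ((insert j J).inf fun i => LinearMap.ker (ψ i)).comap π =
      J.inf fun i => LinearMap.ker (ψ i ∘ₗ π) := by
    have hj : (LinearMap.ker (ψ j)).comap π = ⊤ :=
      eq_top_iff.2 fun v _ => projOnto_mem (LinearMap.ker (ψ j)) v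
    rw [Finset.inf_insert, Submodule.comap_inf, hj, top_inf_eq]
    exact Finset.apply_inf_eq_inf_comp _ (fun _ _ => rfl) rfl
  rw [← hcomap]
  exact vanishingOrder_le_pullback π _ f

theorem orderSum_add_two_le [DecidableEq ι] {a d : ℕ} {f : CoordRing K N}
    (hbound : ∀ j ∈ S, orderSum (fun i => ψ i ∘ₗ projOnto (LinearMap.ker (ψ j))) (S.erase j)
      (a + 1) (pullback (projOnto (LinearMap.ker (ψ j))) f) ≤
        (d * ((S.erase j).card - 1).choose a : ℕ)) :
    orderSum ψ S (a + 2) f ≤ (d * (S.card - 1).choose (a + 1) : ℕ) := by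
  rcases lt_or_ge S.card (a + 2) with hS | hS
  · rw [orderSum, Finset.powersetCard_eq_empty.2 hS, Finset.sum_empty]
    exact zero_le
  obtain ⟨t, ht⟩ := Nat.exists_eq_add_of_le' (le_of_add_le_right hS)
  rw [← ENat.mul_le_mul_left_iff (a := (a + 2 : ℕ)) (by simp) (by simp)]
  calc ((a + 2 : ℕ) : ℕ∞) * orderSum ψ S (a + 2) f
      = ∑ j ∈ S, ∑ J ∈ S.powersetCard (a + 2) with j ∈ J,
          vanishingOrder (J.inf fun i => LinearMap.ker (ψ i)) f := by
        rw [sum_sum_powersetCard_filter_mem, orderSum, nsmul_eq_mul]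
    _ ≤ S.card • ((d * t.choose a : ℕ) : ℕ∞) := by
        refine Finset.sum_le_card_nsmul _ _ _ fun j hj => ?_
        refine (sum_vanishingOrder_filter_mem_le hj (a + 1) f).trans ((hbound j hj).trans_eq ?_)
        rw [Finset.card_erase_of_mem hj, ht]
        rfl
    _ = (((t + 2) * t.choose a * d : ℕ) : ℕ∞) := by
        rw [nsmul_eq_mul, ht, ← Nat.cast_mul, mul_assoc, mul_comm d]
    _ ≤ (((a + 2) * (t + 1).choose (a + 1) * d : ℕ) : ℕ∞) := by
        exact_mod_cast Nat.mul_le_mul_right d (add_two_mul_choose_le t a)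
    _ = ((a + 2 : ℕ) : ℕ∞) * ((d * (S.card - 1).choose (a + 1) : ℕ) : ℕ∞) := by
        rw [ht, ← Nat.cast_mul, mul_assoc, mul_comm d]
        rfl

theorem orderSum_le {a : ℕ} (h : LinearIndepUpTo K ψ S (a + 2)) {f : CoordRing K N}
    (hf : f ≠ 0) :
    orderSum ψ S (a + 1) f ≤ (f.totalDegree * (S.card - 1).choose a : ℕ) := by
  classical
  induction a generalizing ψ S f with
  | zero =>
    refine orderSum_le_of_forall_not_dvd h (fun g hg => ?_) hf
    rw [zero_add, orderSum_one_eq_zero hg]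
    exact zero_le
  | succ a ih =>
    refine orderSum_le_of_forall_not_dvd h (fun g hg => ?_) hf
    refine orderSum_add_two_le fun j hj => ?_
    have hres : pullback (projOnto (LinearMap.ker (ψ j))) g ≠ 0 := fun h0 =>
      hg j hj (linForm_dvd_of_mem_flatIdeal_ker (mem_flatIdeal_iff.2 h0))
    refine (ih (h.erase_comp_projOnto hj) hres).trans ?_
    gcongr
    exact totalDegree_pullback_le _ g

theorem card_mul_le_mul_totalDegree {e n : ℕ} (he : 1 ≤ e) (heS : e ≤ S.card)
    (h : LinearIndepUpTo K ψ S (e + 1)) {f : CoordRing K N} (hf : f ≠ 0)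
    (hn : ∀ J ∈ S.powersetCard e, n ≤ vanishingOrder (J.inf fun j => LinearMap.ker (ψ j)) f) :
    S.card * n ≤ e * f.totalDegree := by
  obtain ⟨a, rfl⟩ := Nat.exists_eq_add_of_le' he
  obtain ⟨t, ht⟩ := Nat.exists_eq_add_of_le' (he.trans heS)
  have hsum : S.card.choose (a + 1) * n ≤ f.totalDegree * t.choose a := by
    have hle := (Finset.card_nsmul_le_sum _ _ _ hn).trans (orderSum_le h hf)
    rw [Finset.card_powersetCard, nsmul_eq_mul, ht] at hle
    rw [ht]
    exact_mod_cast hle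
  refine Nat.le_of_mul_le_mul_left ?_ (Nat.choose_pos heS)
  calc S.card.choose (a + 1) * (S.card * n) = S.card * (S.card.choose (a + 1) * n) := by ring
    _ ≤ S.card * (f.totalDegree * t.choose a) := Nat.mul_le_mul_left _ hsum
    _ = ((t + 1) * t.choose a) * f.totalDegree := by rw [ht]; ring
    _ = (S.card.choose (a + 1) * (a + 1)) * f.totalDegree := by
        rw [Nat.add_one_mul_choose_eq, ht]
    _ = S.card.choose (a + 1) * ((a + 1) * f.totalDegree) := mul_assoc _ _ _

end LowerBound

section SymbolicPowers

variable {R : Type*} [CommRing R]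

theorem associatedPrimes_quotient (I : Ideal R) :
    associatedPrimes R (R ⧸ I) = Submodule.associatedPrimes I := by
  have hcolon (x : R) : (⊥ : Submodule R (R ⧸ I)).colon {Ideal.Quotient.mk I x} = I.colon {x} := by
    ext r
    rw [Submodule.mem_colon_singleton, Submodule.mem_colon_singleton, Submodule.mem_bot,
      smul_eq_mul, ← Ideal.Quotient.eq_zero_iff_mem, map_mul]
    rfl
  ext P
  rw [AssociatedPrimes.mem_iff, IsAssociatedPrime, Submodule.AssociatePrimes.mem_iff,
    Submodule.isAssociatedPrime_def, Submodule.isAssociatedPrime_def,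
    (Ideal.Quotient.mk_surjective (I := I)).exists]
  simp only [hcolon]

theorem mem_symbolicPower_iff {I : Ideal R} {k : ℕ} {f : R} :
    f ∈ symbolicPower I k ↔
      ∀ P ∈ associatedPrimes R (R ⧸ I), ∃ u ∉ P, u * f ∈ I ^ k := by
  have hloc (P : PrimeSpectrum R) := IsLocalization.algebraMap_mem_map_algebraMap_iff
    P.asIdeal.primeCompl (Localization.AtPrime P.asIdeal) (I ^ k) f
  simp only [symbolicPower, Submodule.mem_iInf, Ideal.mem_comap, hloc]
  exact ⟨fun h P hP => h ⟨P, hP.isPrime⟩ hP, fun h P hP => h P.asIdeal hP⟩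

variable {ι : Type*} {s : Finset ι} {Q : ι → Ideal R}

theorem exists_notMem_radical_of_pairwise_not_le (hQ : ∀ i ∈ s, (Q i).IsPrimary)
    (hle : ∀ i ∈ s, ∀ j ∈ s, (Q j).radical ≤ (Q i).radical → j = i) {i : ι} (hi : i ∈ s) :
    ∃ u ∉ (Q i).radical, ∀ j ∈ s, j ≠ i → u ∈ Q j := by
  classical
  have hprime : (Q i).radical.IsPrime := Ideal.isPrime_radical (hQ i hi)
  have hnot : ¬ (s.erase i).inf Q ≤ (Q i).radical := by
    rw [hprime.inf_le']
    rintro ⟨j, hj, hji⟩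
    obtain ⟨hne, hjs⟩ := Finset.mem_erase.1 hj
    exact hne (hle i hi j hjs (hprime.radical_le_iff.2 hji))
  obtain ⟨u, hu, hui⟩ := SetLike.not_le_iff_exists.1 hnot
  exact ⟨u, hui, fun j hj hne => Submodule.mem_finsetInf.1 hu j (Finset.mem_erase.2 ⟨hne, hj⟩)⟩

theorem associatedPrimes_iInf_of_isPrimary (hQ : ∀ i ∈ s, (Q i).IsPrimary)
    (hle : ∀ i ∈ s, ∀ j ∈ s, (Q j).radical ≤ (Q i).radical → j = i) :
    associatedPrimes R (R ⧸ ⨅ i ∈ s, Q i) = (fun i => (Q i).radical) '' s := by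
  classical
  have hmin : Submodule.IsMinimalPrimaryDecomposition (⨅ i ∈ s, Q i) (s.image Q) := by
    refine ⟨by rw [Finset.inf_image, Finset.inf_eq_iInf]; rfl, Finset.forall_mem_image.2 hQ, ?_,
      Finset.forall_mem_image.2 fun i hi hmin => ?_⟩
    · rw [Finset.coe_image]
      rintro _ ⟨i, hi, rfl⟩ _ ⟨j, hj, rfl⟩ hne hrad
      simp only [Submodule.colon_univ] at hrad
      exact hne (congrArg Q (hle j hj i hi hrad.le))
    · obtain ⟨u, hui, hu⟩ := exists_notMem_radical_of_pairwise_not_le hQ hle hi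
      refine hui (Ideal.le_radical (hmin (Submodule.mem_finsetInf.2 fun J hJ => ?_)))
      obtain ⟨hne, hJs⟩ := Finset.mem_erase.1 hJ
      obtain ⟨j, hj, rfl⟩ := Finset.mem_image.1 hJs
      exact hu j hj fun hji => hne (congrArg Q hji)
  rw [associatedPrimes_quotient, ← hmin.image_radical_eq_associated_primes, Finset.coe_image,
    Set.image_image]
  simp only [Submodule.colon_univ]

theorem symbolicPower_iInf_of_isPrimary_pow (hQ : ∀ i ∈ s, ∀ n ≠ 0, (Q i ^ n).IsPrimary)
    (hle : ∀ i ∈ s, ∀ j ∈ s, (Q j).radical ≤ (Q i).radical → j = i) (k : ℕ) :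
    symbolicPower (⨅ i ∈ s, Q i) k = ⨅ i ∈ s, Q i ^ k := by
  have hQ1 (i : ι) (hi : i ∈ s) : (Q i).IsPrimary := pow_one (Q i) ▸ hQ i hi 1 one_ne_zero
  rcases eq_or_ne k 0 with rfl | hk
  · simp [symbolicPower, Ideal.one_eq_top, Ideal.map_top]
  ext f
  simp only [mem_symbolicPower_iff, associatedPrimes_iInf_of_isPrimary hQ1 hle,
    Set.forall_mem_image, Submodule.mem_iInf, Finset.mem_coe]
  refine forall₂_congr fun i hi => ⟨?_, fun hf => ?_⟩
  · rintro ⟨u, hu, huf⟩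
    have hmem : u * f ∈ Q i ^ k := Ideal.pow_right_mono (iInf₂_le i hi) k huf
    refine ((Ideal.isPrimary_iff.1 (hQ i hi k hk)).2 (mul_comm u f ▸ hmem)).resolve_right ?_
    rwa [Ideal.radical_pow _ hk]
  · obtain ⟨u, hu, huQ⟩ := exists_notMem_radical_of_pairwise_not_le hQ1 hle hi
    have hspan : Ideal.span {u} * Q i ≤ ⨅ j ∈ s, Q j := by
      refine le_iInf₂ fun j hj => ?_
      by_cases hji : j = i
      · exact hji ▸ Ideal.mul_le_right
      · exact Ideal.mul_le_left.trans ((Ideal.span_singleton_le_iff_mem _).2 (huQ j hj hji))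
    refine ⟨u ^ k, fun huk => hu ((Ideal.isPrime_radical (hQ1 i hi)).mem_of_pow_mem k huk), ?_⟩
    refine Ideal.pow_right_mono hspan k ?_
    rw [mul_pow, Ideal.span_singleton_pow]
    exact Ideal.mul_mem_mul (Ideal.mem_span_singleton_self _) hf

theorem IsFatFlat.mem_symbolicPower_fatIdeal_iff {K : Type*} [Field K] {N : ℕ} {W : FlatSum K N}
    (hW : IsFatFlat W) {k : ℕ} {f : CoordRing K N} :
    f ∈ symbolicPower (fatIdeal W) k ↔
      ∀ L ∈ W.support, ((W L * k : ℕ) : ℕ∞) ≤ vanishingOrder L f := by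
  have hpos (L : Flat K N) (hL : L ∈ W.support) : W L ≠ 0 := Finsupp.mem_support_iff.1 hL
  have hrad (L : Flat K N) (hL : L ∈ W.support) : (flatIdeal L ^ W L).radical = flatIdeal L := by
    rw [Ideal.radical_pow _ (hpos L hL), (isPrime_flatIdeal L).radical]
  rw [fatIdeal, symbolicPower_iInf_of_isPrimary_pow]
  · simp only [Submodule.mem_iInf, ← pow_mul, le_vanishingOrder_iff]
  · intro L hL n hn
    rw [← pow_mul]
    exact isPrimary_flatIdeal_pow L (mul_ne_zero (hpos L hL) hn)
  · intro L hL L' hL' hle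
    rw [hrad L hL, hrad L' hL', flatIdeal_le_flatIdeal_iff] at hle
    exact (hW.antichain.eq hL hL' hle).symm

end SymbolicPowers

section GeneralPosition

theorem linearIndepOn_dual_iff_finrank_inf_ker {K ι V : Type*} [Field K] [AddCommGroup V]
    [Module K V] [FiniteDimensional K V] {ψ : ι → Module.Dual K V} {J : Finset ι} :
    LinearIndepOn K ψ (J : Set ι) ↔
      Module.finrank K ↥(J.inf fun j => LinearMap.ker (ψ j)) + J.card = Module.finrank K V := by
  have hker : (J.inf fun j => LinearMap.ker (ψ j)) =
      (Submodule.span K (ψ '' J)).dualCoannihilator := by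
    rw [← SetLike.coe_set_eq, Submodule.coe_dualCoannihilator_span]
    ext v
    simp
  have hrank := Subspace.finrank_add_finrank_dualCoannihilator_eq (Submodule.span K (ψ '' J))
  have hcard : Fintype.card (J : Set ι) = J.card := Fintype.card_coe J
  rw [LinearIndepOn, linearIndependent_iff_card_eq_finrank_span, hcard, hker, Set.finrank,
    ← Set.image_eq_range]
  lia

variable {K : Type*} [Field K] {N s : ℕ} {H : Fin s → Flat K N}
  {ψ : Fin s → Module.Dual K (Fin (N + 1) → K)}

theorem inGeneralPosition_ker_iff :
    InGeneralPosition (fun j => LinearMap.ker (ψ j)) ↔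
      LinearIndepUpTo K ψ Finset.univ (N + 1) := by
  simp only [InGeneralPosition, LinearIndepUpTo, linearIndepOn_dual_iff_finrank_inf_ker,
    Module.finrank_fin_fun, Finset.subset_univ, forall_true_left]

theorem InGeneralPosition.exists_eq_ker (hH : InGeneralPosition H) :
    ∃ ψ : Fin s → Module.Dual K (Fin (N + 1) → K), H = fun j => LinearMap.ker (ψ j) := by
  suffices h : ∀ j, ∃ φ : Module.Dual K (Fin (N + 1) → K), H j = LinearMap.ker φ by
    choose ψ hψ using h
    exact ⟨ψ, funext hψ⟩
  intro j
  have hj := hH {j} (by simp)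
  rw [Finset.inf_singleton, Finset.card_singleton] at hj
  have hlt : H j < ⊤ := by
    refine lt_top_iff_ne_top.2 fun h => ?_
    rw [h, finrank_top, Module.finrank_fin_fun] at hj
    lia
  obtain ⟨φ, hφ, hle⟩ := Submodule.exists_le_ker_of_lt_top _ hlt
  refine ⟨φ, Submodule.eq_of_le_of_finrank_eq hle ?_⟩
  have hker := Module.Dual.finrank_ker_add_one_of_ne_zero hφ
  rw [Module.finrank_fin_fun] at hker
  lia

theorem InGeneralPosition.inf_le_iff (hH : InGeneralPosition H) {J : Finset (Fin s)} {j : Fin s}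
    (hJ : J.card ≤ N) : J.inf H ≤ H j ↔ j ∈ J := by
  obtain ⟨ψ, rfl⟩ := hH.exists_eq_ker
  exact (inGeneralPosition_ker_iff.1 hH).inf_ker_le_ker_iff (Finset.subset_univ J)
    (Nat.lt_succ_of_le hJ) (Finset.mem_univ j)

theorem InGeneralPosition.eq_of_inf_le (hH : InGeneralPosition H) {J J' : Finset (Fin s)}
    (hJ : J.card ≤ N) (hcard : J.card ≤ J'.card) (h : J.inf H ≤ J'.inf H) : J' = J :=
  Finset.eq_of_subset_of_card_le
    (fun _ hj => (hH.inf_le_iff hJ).1 (h.trans (Finset.inf_le hj))) hcard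

theorem exists_le_of_subset_iUnion {K ι V : Type*} [Field K] [Infinite K] [AddCommGroup V]
    [Module K V] [Finite ι] {p : ι → Submodule K V} {M : Submodule K V}
    (h : (M : Set V) ⊆ ⋃ j, (p j : Set V)) : ∃ j, M ≤ p j := by
  have hcover : ⋃ j, ((p j).comap M.subtype : Set ↥M) = Set.univ :=
    Set.eq_univ_of_forall fun v => by simpa using h v.2
  obtain ⟨j, hj⟩ := Subspace.exists_eq_top_of_iUnion_eq_univ hcover
  exact ⟨j, Submodule.comap_subtype_eq_top.1 hj⟩

end GeneralPosition

section Star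

variable {K : Type*} [Field K] {N s : ℕ} {H : Fin s → Flat K N} {W' : FlatSum K N} {e m : ℕ}

theorem mem_support_star {L : Flat K N} :
    L ∈ (star H e).support ↔ ∃ J : Finset (Fin s), J.card = e ∧ J.inf H = L := by
  classical
  rw [Finsupp.mem_support_iff, star, Finsupp.finsetSum_apply, Ne, Finset.sum_eq_zero_iff]
  simp [Finsupp.single_apply]

theorem InGeneralPosition.star_inf (hH : InGeneralPosition H) {J : Finset (Fin s)}
    (hJ : J.card ≤ N) : star H J.card (J.inf H) = 1 := by
  classical
  rw [star, Finsupp.finsetSum_apply, Finset.sum_eq_single_of_mem J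
    (Finset.mem_powersetCard.2 ⟨Finset.subset_univ J, rfl⟩), Finsupp.single_eq_same]
  intro J' hJ' hne
  refine Finsupp.single_eq_of_ne fun h => hne ?_
  exact hH.eq_of_inf_le hJ (Finset.mem_powersetCard.1 hJ').2.ge h.le

theorem mem_support_add_smul_star (hm : 1 ≤ m) {L : Flat K N} :
    L ∈ (W' + m • star H e).support ↔ L ∈ W'.support ∨ L ∈ (star H e).support := by
  simp only [Finsupp.mem_support_iff, Finsupp.add_apply, Finsupp.smul_apply, smul_eq_mul, Ne,
    Nat.add_eq_zero_iff, mul_eq_zero, Nat.one_le_iff_ne_zero.1 hm, false_or, not_and_or]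

theorem isAdmissible_zero (hH : InGeneralPosition H) (heN : e ≤ N) (m : ℕ) :
    IsAdmissible H e m 0 where
  codim := by simp
  subset_union := by simp
  disjoint_star := by simp
  mult_le := by simp
  antichain := by
    intro L hL L' hL' hne hle
    rw [zero_add, Finset.mem_coe] at hL hL'
    obtain ⟨J, hJ, rfl⟩ := mem_support_star.1 (Finsupp.support_smul hL)
    obtain ⟨J', hJ', rfl⟩ := mem_support_star.1 (Finsupp.support_smul hL')
    exact hne (by rw [hH.eq_of_inf_le (hJ.trans_le heN) (hJ.trans hJ'.symm).le hle])

namespace IsAdmissible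

theorem isFatFlat (hW : IsAdmissible H e m W') (hH : InGeneralPosition H) (he : 1 ≤ e)
    (heN : e ≤ N) (hes : e ≤ s) (hm : 1 ≤ m) : IsFatFlat (W' + m • star H e) where
  nonempty := by
    obtain ⟨J, -, hJ⟩ := Finset.exists_subset_card_eq (Finset.card_fin s ▸ hes)
    exact ⟨J.inf H, (mem_support_add_smul_star hm).2 (.inr (mem_support_star.2 ⟨J, hJ, rfl⟩))⟩
  proper := by
    intro L hL
    have hcodim : ∃ i, 1 ≤ i ∧ i ≤ N ∧ Module.finrank K ↥L + i = N + 1 := by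
      obtain hL | hL := (mem_support_add_smul_star hm).1 hL
      · obtain ⟨i, hi2, hi⟩ := hW.codim L hL
        exact ⟨i, one_le_two.trans hi2, hi⟩
      · obtain ⟨J, rfl, rfl⟩ := mem_support_star.1 hL
        exact ⟨J.card, he, heN, hH J (heN.trans N.le_succ)⟩
    obtain ⟨i, hi1, hiN, hi⟩ := hcodim
    constructor <;> rintro rfl
    · rw [finrank_bot] at hi
      lia
    · rw [finrank_top, Module.finrank_fin_fun] at hi
      lia
  antichain := hW.antichain

theorem apply_inf (hW : IsAdmissible H e m W') (hH : InGeneralPosition H) (heN : e ≤ N)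
    {J : Finset (Fin s)} (hJ : J.card = e) : (W' + m • star H e) (J.inf H) = m := by
  have hW' : W' (J.inf H) = 0 := Finsupp.notMem_support_iff.1
    (Finset.disjoint_right.1 hW.disjoint_star (mem_support_star.2 ⟨J, hJ, rfl⟩))
  subst hJ
  simp [hW', hH.star_inf heN]

theorem apply_of_mem_support (hW : IsAdmissible H e m W') {M : Flat K N} (hM : M ∈ W'.support) :
    (W' + m • star H e) M ≤ m / e := by
  have hstar : star H e M = 0 :=
    Finsupp.notMem_support_iff.1 (Finset.disjoint_left.1 hW.disjoint_star hM)
  simpa [hstar] using hW.mult_le M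

theorem exists_apply_mul_le_mul_card [Infinite K] (hW : IsAdmissible H e m W')
    (hH : InGeneralPosition H) (heN : e ≤ N) (hm : 1 ≤ m) {L : Flat K N}
    (hL : L ∈ (W' + m • star H e).support) :
    ∃ J : Finset (Fin s), (∀ j ∈ J, L ≤ H j) ∧ (W' + m • star H e) L * e ≤ m * J.card := by
  obtain hL | hL := (mem_support_add_smul_star hm).1 hL
  · obtain ⟨j, hj⟩ := exists_le_of_subset_iUnion (hW.subset_union L hL)
    refine ⟨{j}, by simpa using hj, ?_⟩
    rw [Finset.card_singleton, mul_one]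
    exact (Nat.mul_le_mul_right e (hW.apply_of_mem_support hL)).trans (Nat.div_mul_le_self m e)
  · obtain ⟨J, hJ, rfl⟩ := mem_support_star.1 hL
    exact ⟨J, fun j hj => Finset.inf_le hj, by rw [hW.apply_inf hH heN hJ, hJ]⟩

end IsAdmissible

end Star

section WaldschmidtConstant

variable {K : Type*} [Field K] {N : ℕ}

theorem card_mul_le_vanishingOrder_prod_linForm_pow {ι : Type*} {S J : Finset ι}
    {ψ : ι → Module.Dual K (Fin (N + 1) → K)} {L : Flat K N} (hJS : J ⊆ S)
    (hJ : ∀ j ∈ J, L ≤ LinearMap.ker (ψ j)) (q : ℕ) :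
    ((J.card * q : ℕ) : ℕ∞) ≤ vanishingOrder L (∏ j ∈ S, linForm (ψ j) ^ q) := by
  rw [le_vanishingOrder_iff]
  refine Ideal.mem_of_dvd _ (Finset.prod_dvd_prod_of_subset J S _ hJS) ?_
  rw [Finset.prod_pow, pow_mul, ← Finset.prod_const]
  exact Ideal.pow_mem_pow (Ideal.prod_mem_prod fun j hj => linForm_mem_flatIdeal_iff.2 (hJ j hj)) q

theorem tendsto_div_of_mul_le_of_le_mul_add {α : ℕ → ℕ} {c e C : ℕ} (he : 1 ≤ e)
    (hlower : ∀ k, c * k ≤ e * α k) (hupper : ∀ k, e * α k ≤ c * k + C) :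
    Tendsto (fun k => (α k : ℝ) / k) atTop (𝓝 ((c : ℝ) / e)) := by
  have he' : (0 : ℝ) < e := by exact_mod_cast he
  have hlim : Tendsto (fun k : ℕ => (c : ℝ) / e + (C / e : ℝ) / k) atTop (𝓝 ((c : ℝ) / e)) := by
    simpa using tendsto_const_nhds.add (tendsto_const_div_atTop_nhds_zero_nat (C / e : ℝ))
  refine tendsto_of_tendsto_of_tendsto_of_le_of_le' tendsto_const_nhds hlim ?_ ?_ <;>
    filter_upwards [eventually_gt_atTop 0] with k hk <;>
    have hk' : (0 : ℝ) < k := by exact_mod_cast hk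
  · rw [div_le_div_iff₀ he' hk', mul_comm (α k : ℝ)]
    exact_mod_cast hlower k
  · have hle : (e : ℝ) * α k ≤ c * k + C := by exact_mod_cast hupper k
    calc (α k : ℝ) / k = e * α k / (e * k) := (mul_div_mul_left _ _ he'.ne').symm
      _ ≤ (c * k + C) / (e * k) := by gcongr
      _ = c / e + C / e / k := by field_simp

namespace IsAdmissible

variable {s e m : ℕ} {W' : FlatSum K N} {H : Fin s → Flat K N}

theorem exists_mem_symbolicPower [Infinite K] (hW : IsAdmissible H e m W')
    (hH : InGeneralPosition H) (he : 1 ≤ e) (heN : e ≤ N) (hes : e ≤ s) (hm : 1 ≤ m) (k : ℕ) :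
    ∃ f ∈ symbolicPower (fatIdeal (W' + m • star H e)) k,
      f ≠ 0 ∧ f.IsHomogeneous (s * (m * k / e + 1)) := by
  obtain ⟨ψ, rfl⟩ := hH.exists_eq_ker
  set q := m * k / e + 1
  refine ⟨∏ j, linForm (ψ j) ^ q,
    (hW.isFatFlat hH he heN hes hm).mem_symbolicPower_fatIdeal_iff.2 fun L hL => ?_, ?_, ?_⟩
  · obtain ⟨J, hJ, hmul⟩ := hW.exists_apply_mul_le_mul_card hH heN hm hL
    generalize (W' + m • star (fun j => LinearMap.ker (ψ j)) e) L = n at hmul ⊢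
    refine le_trans ?_
      (card_mul_le_vanishingOrder_prod_linForm_pow (Finset.subset_univ J) hJ q)
    refine Nat.cast_le.2 (Nat.le_of_mul_le_mul_left ?_ he)
    calc e * (n * k) = n * e * k := by ring
      _ ≤ m * J.card * k := Nat.mul_le_mul_right k hmul
      _ = J.card * (m * k) := by ring
      _ ≤ J.card * (e * q) := Nat.mul_le_mul_left _ (Nat.lt_mul_div_succ (m * k) he).le
      _ = e * (J.card * q) := by ring
  · refine Finset.prod_ne_zero_iff.2 fun j hj => pow_ne_zero q ?_
    rw [Ne, map_eq_zero_iff _ linForm_injective]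
    exact (inGeneralPosition_ker_iff.1 hH).ne_zero hj
  · have hprod := MvPolynomial.IsHomogeneous.prod Finset.univ (fun j => linForm (ψ j) ^ q)
      (fun _ => 1 * q) fun j _ => (isHomogeneous_linForm (ψ j)).pow q
    simpa using hprod

theorem mul_le_mul_totalDegree (hW : IsAdmissible H e m W')
    (hH : InGeneralPosition H) (he : 1 ≤ e) (heN : e ≤ N) (hes : e ≤ s) (hm : 1 ≤ m) {k : ℕ}
    {f : CoordRing K N} (hf : f ∈ symbolicPower (fatIdeal (W' + m • star H e)) k) (hf0 : f ≠ 0) :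
    s * (m * k) ≤ e * f.totalDegree := by
  obtain ⟨ψ, rfl⟩ := hH.exists_eq_ker
  have hind := (inGeneralPosition_ker_iff.1 hH).mono subset_rfl (Nat.succ_le_succ heN)
  have hord := (hW.isFatFlat hH he heN hes hm).mem_symbolicPower_fatIdeal_iff.1 hf
  have hbound := card_mul_le_mul_totalDegree (n := m * k) he (by simpa using hes) hind hf0
    fun J hJ => by
      have hJe := (Finset.mem_powersetCard.1 hJ).2
      rw [← hW.apply_inf hH heN hJe]
      exact hord _ ((mem_support_add_smul_star hm).2 (.inr (mem_support_star.2 ⟨J, hJe, rfl⟩)))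
  rwa [Finset.card_fin] at hbound

theorem hasWaldschmidtConstant [Infinite K] (hW : IsAdmissible H e m W')
    (hH : InGeneralPosition H) (he : 1 ≤ e) (heN : e ≤ N) (hes : e ≤ s) (hm : 1 ≤ m) :
    HasWaldschmidtConstant (fatIdeal (W' + m • star H e)) ((s * m : ℕ) / e : ℝ) := by
  have hex := hW.exists_mem_symbolicPower hH he heN hes hm
  refine tendsto_div_of_mul_le_of_le_mul_add (C := s * e) he (fun k => ?_) fun k => ?_
  · obtain ⟨f, hf, hf0, hhom⟩ := Nat.sInf_mem (s := {t : ℕ | ∃ f ∈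
      symbolicPower (fatIdeal (W' + m • star H e)) k, f ≠ 0 ∧ f.IsHomogeneous t}) ⟨_, hex k⟩
    rw [mul_assoc, initialDegree, ← hhom.totalDegree hf0]
    exact hW.mul_le_mul_totalDegree hH he heN hes hm hf hf0
  · calc e * initialDegree _ ≤ e * (s * (m * k / e + 1)) :=
          Nat.mul_le_mul_left e (Nat.sInf_le (hex k))
      _ = s * (m * k / e * e) + s * e := by ring
      _ ≤ s * (m * k) + s * e := by
          grw [Nat.div_mul_le_self]
      _ = s * m * k + s * e := by rw [mul_assoc]

end IsAdmissible

end WaldschmidtConstant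

section Existence

variable {K : Type*} [Field K]

/-- The functional on `K^(N+1)` that evaluates the polynomial with given coefficients at `t`. -/
def evalFunctional (N : ℕ) (t : K) : Module.Dual K (Fin (N + 1) → K) :=
  ∑ i : Fin (N + 1), t ^ (i : ℕ) • LinearMap.proj i

theorem evalFunctional_coeff {N : ℕ} {p : Polynomial K} (hp : p.natDegree ≤ N) (t : K) :
    evalFunctional N t (fun i => p.coeff i) = p.eval t := by
  rw [Polynomial.eval_eq_sum_range' (Nat.lt_succ_of_le hp), Finset.sum_range]
  simp [evalFunctional, mul_comm]

theorem linearIndepUpTo_evalFunctional {ι : Type*} {t : ι → K} (ht : Function.Injective t)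
    (N : ℕ) (S : Finset ι) :
    LinearIndepUpTo K (fun j => evalFunctional N (t j)) S (N + 1) := by
  classical
  intro J _ hJ
  have hdeg (i : J) : (Lagrange.basis J t i).natDegree ≤ N := by
    rw [Lagrange.natDegree_basis ht.injOn i.2]
    lia
  refine LinearIndependent.of_pairwise_dual_eq_zero_one _
    (fun i : J => Module.Dual.eval K _ fun n : Fin (N + 1) => (Lagrange.basis J t i).coeff n)
    (fun i j hij => ?_) fun i => ?_
  · exact (evalFunctional_coeff (hdeg i) _).trans
      (Lagrange.eval_basis_of_ne (Subtype.coe_injective.ne hij) j.2)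
  · exact (evalFunctional_coeff (hdeg i) _).trans (Lagrange.eval_basis_self ht.injOn i.2)

theorem exists_inGeneralPosition (K : Type*) [Field K] [Infinite K] (N s : ℕ) :
    ∃ H : Fin s → Flat K N, InGeneralPosition H :=
  ⟨_, inGeneralPosition_ker_iff.2 (linearIndepUpTo_evalFunctional
    ((Infinite.natEmbedding K).injective.comp Fin.val_injective) N Finset.univ)⟩

end Existence

end FatFlats

end

theorem mainTheorem4 (K : Type*) [Field K] [Infinite K] (a b N : ℕ)
    (ha : 1 ≤ a) (hab : a < b) (hN : a ≤ N) :
    -- some fat flat subscheme of `ℙ^N` has Waldschmidt constant `b / a`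
    (∃ W : FatFlats.FlatSum K N, FatFlats.IsFatFlat W ∧
      FatFlats.HasWaldschmidtConstant (FatFlats.fatIdeal W) ((b : ℝ) / a)) ∧
    -- for `b = s m` with `a ≤ s`, each `W' + m S_N(a,s)` is one, and such schemes exist
    (∀ s m : ℕ, b = s * m → a ≤ s →
      (∃ H : Fin s → FatFlats.Flat K N, FatFlats.InGeneralPosition H ∧
        ∃ W' : FatFlats.FlatSum K N, FatFlats.IsAdmissible H a m W') ∧
      ∀ H : Fin s → FatFlats.Flat K N, FatFlats.InGeneralPosition H →
        ∀ W' : FatFlats.FlatSum K N, FatFlats.IsAdmissible H a m W' →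
          FatFlats.IsFatFlat (W' + m • FatFlats.star H a) ∧
          FatFlats.HasWaldschmidtConstant
            (FatFlats.fatIdeal (W' + m • FatFlats.star H a)) ((b : ℝ) / a)) ∧
    -- each star configuration `S_N(a,b)` is one, and such configurations exist
    ((∃ H : Fin b → FatFlats.Flat K N, FatFlats.InGeneralPosition H) ∧
      ∀ H : Fin b → FatFlats.Flat K N, FatFlats.InGeneralPosition H →
        FatFlats.IsFatFlat (FatFlats.star H a) ∧
        FatFlats.HasWaldschmidtConstant
          (FatFlats.fatIdeal (FatFlats.star H a)) ((b : ℝ) / a)) := by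
  have hscheme : ∀ s m : ℕ, b = s * m → a ≤ s → ∀ H : Fin s → FatFlats.Flat K N,
      FatFlats.InGeneralPosition H → ∀ W' : FatFlats.FlatSum K N, FatFlats.IsAdmissible H a m W' →
        FatFlats.IsFatFlat (W' + m • FatFlats.star H a) ∧
        FatFlats.HasWaldschmidtConstant
          (FatFlats.fatIdeal (W' + m • FatFlats.star H a)) ((b : ℝ) / a) := by
    rintro s m rfl has H hH W' hW
    have hm : 1 ≤ m := Nat.pos_of_mul_pos_left (ha.trans hab.le)
    exact ⟨hW.isFatFlat hH ha hN has hm, hW.hasWaldschmidtConstant hH ha hN has hm⟩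
  have hstar : ∀ H : Fin b → FatFlats.Flat K N, FatFlats.InGeneralPosition H →
      FatFlats.IsFatFlat (FatFlats.star H a) ∧
      FatFlats.HasWaldschmidtConstant (FatFlats.fatIdeal (FatFlats.star H a)) ((b : ℝ) / a) := by
    intro H hH
    simpa only [zero_add, one_smul] using
      hscheme b 1 (mul_one b).symm hab.le H hH 0 (FatFlats.isAdmissible_zero hH hN 1)
  obtain ⟨H, hH⟩ := FatFlats.exists_inGeneralPosition K N b
  refine ⟨⟨_, hstar H hH⟩, fun s m hb has => ⟨?_, hscheme s m hb has⟩, ⟨H, hH⟩, hstar⟩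
  obtain ⟨H, hH⟩ := FatFlats.exists_inGeneralPosition K N s
  exact ⟨H, hH, 0, FatFlats.isAdmissible_zero hH hN m⟩
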